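/- A Bratteli diagram $B=(V^*,E)$ has vertex set $V^*=\bigcup_{n\ge 0}V_n$ and edge set $E=\bigcup_{n\ge1}E_n$, all $V_n,E_n$ finite, $V_0=\{v_0\}$, with source and range maps satisfying $s(E_n)=V_{n-1}$, $r(E_n)=V_n$, $s^{-1}(v)\neq\emptyset$ for all $v\in V^*$ and $r^{-1}(v)\ne\emptyset$ for all $v\ne v_0$. Let $X_B$ be the space of infinite paths starting at $v_0$, with the topology generated by cylinder sets. $B$ is *simple* if for every $n$ there is $m>n$ such that every vertex of $V_n$ is joined to every vertex of $V_m$ by a path. $B$ is *of strict rank $d$* if $V_n=V$ for all $n\ge1$, where $|V|=d$, and $|r^{-1}(v)|\ge 2$ for every $v\neq v_0$; it is *of strict finite rank* if this holds for some $d$. An *ordering* $\omega$ on $B$ is a choice of a linear order on each $r^{-1}(v)$, $v\ne v_0$. An infinite path is *maximal* (*minimal*) if each of its edges is maximal (minimal) among the edges with the same range. A *Vershik map* for $\omega$ is a homeomorphism $\varphi_\omega$ of $X_B$ that maps the set of maximal paths onto the set of minimal paths and sends each non-maximal path $x=(x_1,x_2,\dots)$, with $k$ least such that $x_k$ is not maximal,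 to $(x_1^0,\dots,x_{k-1}^0,\overline{x_k},x_{k+1},\dots)$, where $\overline{x_k}$ is the successor of $x_k$ in $r^{-1}(r(x_k))$ and $(x_1^0,\dots,x_{k-1}^0)$ is the minimal path from $v_0$ to $s(\overline{x_k})$. The ordering $\omega$ is *perfect* if it admits a Vershik map. Suppose $V_n=V$ for all $n\ge 1$. For $v\in V_n$ and $1\le m<n$ let $w(v,m,n)$ be the word over $V$ formed by the sources of the paths from $V_m$ to $v$, listed in increasing lexicographic order (edges of higher level are compared first). The *language* $\mathcal L_{B,\omega}$ is the set of words that, for infinitely many $n$, are subwords of $w(v_n,m_n,n)$ for some $v_n\in V_n$ and $1\le m_n<n$. It is *periodic* if there is a word $U\in\mathcal L_{B,\omega}$ such that every $W\in\mathcal L_{B,\omega}$ either has the form $SU^kP$ with $k\ge0$, $S$ a suffix of $U$ and $P$ a prefix of $U$, or is a subword of $U$. A *minimal Cantor system* is a homeomorphism, all of whose orbits are dense, of a nonempty compact metrizable totally disconnected space without isolated points. An *odometer* is a minimal Cantor system that is topologically conjugate to $(X_{B'},\varphi_{\omega'})$ for some Bratteli diagram $B'$ with exactly one vertex at each level and some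 ordering $\omega'$ on $B'$ with Vershik map $\varphi_{\omega'}$. **Proposition.** Let $\omega$ be a perfect ordering on a simple Bratteli diagram $B$ of strict finite rank. If the language $\mathcal L_{B,\omega}$ is periodic, then $(X_B,\varphi_\omega)$ is topologically conjugate to an odometer, for every Vershik map $\varphi_\omega$ of $\omega$. -/

import Mathlib

open Filter Topology

universe u v w

/-- A Bratteli diagram. `V n` is the `n`-th vertex set; `E n` is the set of edges going from
`V n` to `V (n + 1)` (so the edges are numbered from `0`), with source `s` and range `r`. -/
structure BratteliDiagram : Type (max (u + 1) (v + 1)) where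
  V : ℕ → Type u
  E : ℕ → Type v
  finite_V : ∀ n, Finite (V n)
  finite_E : ∀ n, Finite (E n)
  s : ∀ {n : ℕ}, E n → V n
  r : ∀ {n : ℕ}, E n → V (n + 1)
  card_V_zero : Nat.card (V 0) = 1
  s_surjective : ∀ n, Function.Surjective (s : E n → V n)
  r_surjective : ∀ n, Function.Surjective (r : E n → V (n + 1))

namespace BratteliDiagram

/-- `X_B`: the infinite paths `x 0, x 1, …` starting at the top vertex. -/
def PathSpace (B : BratteliDiagram.{u, v}) : Type v :=
  {x : ∀ n, B.E n // ∀ n, B.r (x n) = B.s (x (n + 1))}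

/-- The topology of `X_B` generated by cylinder sets: the one induced by the product of the
discrete topologies on the edge sets. -/
instance (B : BratteliDiagram.{u, v}) : TopologicalSpace B.PathSpace :=
  TopologicalSpace.induced (fun x : B.PathSpace => x.1)
    (@Pi.topologicalSpace ℕ B.E (fun _ => ⊥))

/-- `B.Connected n k a b`: there is a finite path (with `k` edges) from `a ∈ V n` to
`b ∈ V (n + k)`. -/
def Connected (B : BratteliDiagram.{u, v}) (n : ℕ) : ∀ k : ℕ, B.V n → B.V (n + k) → Prop
  | 0, a, b => a = b
  | k + 1, a, b => ∃ e : B.E (n + k), B.r e = b ∧ B.Connected n k a (B.s e)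

/-- For every level `n` there is a level `n + k > n` such that every vertex of level `n` is
joined by a path to every vertex of level `n + k`. -/
def IsSimple (B : BratteliDiagram.{u, v}) : Prop :=
  ∀ n, ∃ k, 0 < k ∧ ∀ (a : B.V n) (b : B.V (n + k)), B.Connected n k a b

/-- `B` is strictly rank `d`: all vertex sets `V 1, V 2, …` are one and the same set `A` of
cardinality `d` (through the labellings `lab n : V (n + 1) ≃ A`), and every vertex other than
the top one is the range of at least two edges. -/
structure IsStrictRank (B : BratteliDiagram.{u, v}) {A : Type w}
    (lab : ∀ n, B.V (n + 1) ≃ A) (d : ℕ) : Prop where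
  card_eq : Nat.card A = d
  two_le : ∀ (n : ℕ) (a : B.V (n + 1)), 2 ≤ Nat.card {e : B.E n // B.r e = a}

/-- An ordering `ω` on `B`: a linear order on each set `r⁻¹(a)`. -/
structure EdgeOrder (B : BratteliDiagram.{u, v}) where
  order : ∀ (n : ℕ) (a : B.V (n + 1)), LinearOrder {e : B.E n // B.r e = a}

namespace EdgeOrder

variable {B : BratteliDiagram.{u, v}} (ω : B.EdgeOrder)

/-- `e < f` in the ordering `ω`; in particular `e` and `f` have the same range. -/
def Lt {n : ℕ} (e f : B.E n) : Prop :=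
  ∃ h : B.r e = B.r f, (ω.order n (B.r f)).lt ⟨e, h⟩ ⟨f, rfl⟩

/-- `e` is maximal in `r⁻¹(r(e))`. -/
def IsMaxEdge {n : ℕ} (e : B.E n) : Prop := ∀ f : B.E n, ¬ ω.Lt e f

/-- `e` is minimal in `r⁻¹(r(e))`. -/
def IsMinEdge {n : ℕ} (e : B.E n) : Prop := ∀ f : B.E n, ¬ ω.Lt f e

/-- `f` is the successor of `e` in `r⁻¹(r(e))`. -/
def IsSucc {n : ℕ} (e f : B.E n) : Prop := ω.Lt e f ∧ ∀ g : B.E n, ¬ (ω.Lt e g ∧ ω.Lt g f)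

/-- The set of maximal infinite paths. -/
def maxPaths : Set B.PathSpace := {x | ∀ n, ω.IsMaxEdge (x.1 n)}

/-- The set of minimal infinite paths. -/
def minPaths : Set B.PathSpace := {x | ∀ n, ω.IsMinEdge (x.1 n)}

/-- `φ` is a (continuous) Vershik map: it maps the maximal paths onto the minimal ones and, if
`x k` is the first edge of `x` which is not maximal, then `φ x` has minimal edges before `k`,
the successor of `x k` at `k`, and agrees with `x` after `k`. -/
structure IsVershikMap (φ : B.PathSpace ≃ₜ B.PathSpace) : Prop where
  image_maxPaths : φ '' ω.maxPaths = ω.minPaths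
  map_of_not_max : ∀ (x : B.PathSpace) (k : ℕ),
    (∀ j < k, ω.IsMaxEdge (x.1 j)) → ¬ ω.IsMaxEdge (x.1 k) →
      (∀ j < k, ω.IsMinEdge ((φ x).1 j)) ∧ ω.IsSucc (x.1 k) ((φ x).1 k) ∧
        ∀ j, k < j → (φ x).1 j = x.1 j

/-- `ω` is perfect if it admits a Vershik map. -/
def IsPerfect : Prop := ∃ φ : B.PathSpace ≃ₜ B.PathSpace, ω.IsVershikMap φ

/-- The edges with range `a`, listed in increasing order. -/
noncomputable def edgesInto {n : ℕ} (a : B.V (n + 1)) : List (B.E n) :=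
  letI : LinearOrder {e : B.E n // B.r e = a} := ω.order n a
  haveI : Finite (B.E n) := B.finite_E n
  letI : Fintype {e : B.E n // B.r e = a} := Fintype.ofFinite _
  ((Finset.univ : Finset {e : B.E n // B.r e = a}).sort).map Subtype.val

/-- The sources of all finite paths from level `m` to the vertex `a` of level `m + k`, listed in
the increasing lexicographic order of these paths. In that order the edges of the last level are
compared first, so the list is a concatenation over the ordered edges with range `a`. -/
noncomputable def sources (m : ℕ) : ∀ k : ℕ, B.V (m + k) → List (B.V m)
  | 0, a => [a]
  | k + 1, a => (ω.edgesInto (n := m + k) a).flatMap fun e => sources m k (B.s e)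

/-- The word `w(a, m, m + k)` over `A`, for a vertex `a` of level `m + k` and `m ≥ 1`. The level
`m ≥ 1` is written as `m' + 1`. -/
noncomputable def word {A : Type w} (lab : ∀ n, B.V (n + 1) ≃ A) (m' k : ℕ)
    (a : B.V (m' + 1 + k)) : List A :=
  (ω.sources (m' + 1) k a).map (lab m')

/-- The language of `(B, ω)`: the words which, for infinitely many `n`, are subwords of some
`w(a, m, n)` with `a ∈ V n` and `1 ≤ m < n`. -/
def language {A : Type w} (lab : ∀ n, B.V (n + 1) ≃ A) : Set (List A) :=
  {u | ∃ᶠ n in atTop, ∃ (m' k : ℕ) (a : B.V (m' + 1 + k)),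
    0 < k ∧ m' + 1 + k = n ∧ u <:+: ω.word lab m' k a}

end EdgeOrder

end BratteliDiagram

/-- A language is periodic if it contains a word `U` such that each of its words either has the
form `S U ^ k P`, with `S` a suffix and `P` a prefix of `U`, or is a subword of `U`. -/
def IsPeriodicLanguage {A : Type w} (L : Set (List A)) : Prop :=
  ∃ U ∈ L, ∀ W ∈ L,
    (∃ (S P : List A) (k : ℕ), S <:+ U ∧ P <+: U ∧ W = S ++ (List.replicate k U).flatten ++ P) ∨
      W <:+: U

/-- `h ∘ T = S ∘ h` for some homeomorphism `h`. -/
def TopologicallyConjugate {X : Type u} {Y : Type v} [TopologicalSpace X] [TopologicalSpace Y]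
    (T : X ≃ₜ X) (S : Y ≃ₜ Y) : Prop :=
  ∃ h : X ≃ₜ Y, ∀ x, h (T x) = S (h x)

/-- A nonempty compact metrizable totally disconnected space without isolated points. -/
structure IsCantorSpace (Y : Type u) [TopologicalSpace Y] : Prop where
  nonempty : Nonempty Y
  compact : CompactSpace Y
  metrizable : TopologicalSpace.MetrizableSpace Y
  totallyDisconnected : TotallyDisconnectedSpace Y
  perfect : PerfectSpace Y

/-- Every orbit of `T` is dense. -/
def IsMinimalSystem {Y : Type u} [TopologicalSpace Y] (T : Y ≃ₜ Y) : Prop :=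
  ∀ y, Dense (Set.range fun k : ℤ => (T ^ k) y)

/-- An odometer: a minimal Cantor system that admits an adic representation by a Bratteli
diagram with exactly one vertex at each level. -/
structure IsOdometer {Y : Type u} [TopologicalSpace Y] (T : Y ≃ₜ Y) : Prop where
  cantor : IsCantorSpace Y
  minimal : IsMinimalSystem T
  adic : ∃ (B : BratteliDiagram.{0, 0}) (ω : B.EdgeOrder) (ψ : B.PathSpace ≃ₜ B.PathSpace),
    (∀ n, Nat.card (B.V n) = 1) ∧ ω.IsVershikMap ψ ∧ TopologicallyConjugate T ψ

/-! The paths whose first `n` edges are minimal form the base of Kakutani–Rokhlin towers, one over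
each vertex of level `n`, whose floors are the cylinders of length `n`; the tower over `a` has
`height n a` floors. The tower of level `n + 1` over `a` is a stack of towers of level `n`, in the
order of the edges into `a`. Hence the word of a vertex is the itinerary of a base point through the
lower towers (`walk_sources`).

If the language is generated by `U`, all its words have period `p = |U|`, and so has the itinerary
of a minimal path through the towers of each level `m ≥ 1`. The total height `H` of `p` consecutive
towers is then a period of its visits to the cylinders of length `m`. Its orbit is dense by
simplicity, so `φ ^ H` preserves every cylinder of length `m` (`exists_pow_agree_self`).

Such a `φ` is an inverse limit of finite rotations: if `q m` generates the group of exponents `k`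
for which `φ ^ k` preserves the cylinders of length `m`, the position modulo `q m` along a fixed
orbit extends to a clopen map `f m` that turns `φ` into addition of `1`. These maps separate points,
and the mixed-radix digits of their values give the conjugacy with an adic map on a diagram with one
vertex per level (`exists_odometer_conj`). -/

namespace BratteliDiagram

/-! ### The path space and its cylinder sets. -/

section PathSpace

variable (B : BratteliDiagram.{u, v})

theorem nonempty_V (n : ℕ) : Nonempty (B.V n) := by
  induction n with
  | zero =>
    have h : Nat.card (B.V 0) ≠ 0 := by rw [B.card_V_zero]; exact one_ne_zero
    exact (Nat.card_ne_zero.1 h).1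
  | succ n ih =>
    obtain ⟨a⟩ := ih
    obtain ⟨e, -⟩ := B.s_surjective n a
    exact ⟨B.r e⟩

theorem nonempty_E (n : ℕ) : Nonempty (B.E n) := by
  obtain ⟨a⟩ := B.nonempty_V n
  obtain ⟨e, -⟩ := B.s_surjective n a
  exact ⟨e⟩

instance : Nonempty B.PathSpace := by
  obtain ⟨e₀⟩ := B.nonempty_E 0
  have hnext : ∀ n (e : B.E n), ∃ f : B.E (n + 1), B.r e = B.s f := fun n e => by
    obtain ⟨f, hf⟩ := B.s_surjective (n + 1) (B.r e)
    exact ⟨f, hf.symm⟩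
  choose next hnext using hnext
  exact ⟨⟨fun n => Nat.rec (motive := fun n => B.E n) e₀ (fun n e => next n e) n,
    fun n => hnext n _⟩⟩

/-- The path space is a closed subspace of a product of finite discrete spaces. The edge sets carry
no global topology, so everything that needs the discrete one is gathered here. -/
theorem pathSpace_topology :
    CompactSpace B.PathSpace ∧ TopologicalSpace.MetrizableSpace B.PathSpace ∧
      TotallyDisconnectedSpace B.PathSpace ∧
        ∀ (n : ℕ) (s : Set (B.E n)), IsClopen {x : B.PathSpace | x.1 n ∈ s} := by
  let : ∀ n, TopologicalSpace (B.E n) := fun _ => ⊥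
  have : ∀ n, DiscreteTopology (B.E n) := fun _ => ⟨rfl⟩
  have : ∀ n, Finite (B.E n) := B.finite_E
  have hemb : IsEmbedding (fun x : B.PathSpace => x.1) := ⟨⟨rfl⟩, Subtype.val_injective⟩
  have hclosed : IsClosedEmbedding (fun x : B.PathSpace => x.1) := by
    refine ⟨hemb, ?_⟩
    have : Set.range (fun x : B.PathSpace => x.1) =
        ⋂ n, {x : ∀ n, B.E n | B.r (x n) = B.s (x (n + 1))} := by
      ext x
      simp only [Set.mem_range, Set.mem_iInter, Set.mem_ofPred_eq]
      exact ⟨fun ⟨y, hy⟩ => hy ▸ y.2, fun h => ⟨⟨x, h⟩, rfl⟩⟩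
    rw [this]
    refine isClosed_iInter fun n => ?_
    have hc : Continuous fun x : ∀ n, B.E n => (x n, x (n + 1)) :=
      (continuous_apply n).prodMk (continuous_apply (n + 1))
    exact (isClosed_discrete {p : B.E n × B.E (n + 1) | B.r p.1 = B.s p.2}).preimage hc
  refine ⟨hclosed.compactSpace, hemb.metrizableSpace, ?_, fun n s => ?_⟩
  · refine ⟨?_⟩
    have := hemb.isTotallyDisconnected (s := (Set.univ : Set B.PathSpace))
      (isTotallyDisconnected_of_totallyDisconnectedSpace _)
    exact this
  · exact (isClopen_discrete s).preimage ((continuous_apply n).comp hemb.continuous)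

instance : CompactSpace B.PathSpace := B.pathSpace_topology.1

instance : TopologicalSpace.MetrizableSpace B.PathSpace := B.pathSpace_topology.2.1

instance : TotallyDisconnectedSpace B.PathSpace := B.pathSpace_topology.2.2.1

variable {B}

theorem isClopen_coord (n : ℕ) (s : Set (B.E n)) : IsClopen {x : B.PathSpace | x.1 n ∈ s} :=
  B.pathSpace_topology.2.2.2 n s

/-- The paths `x` and `y` have the same first `m` edges. -/
def Agree (m : ℕ) (x y : B.PathSpace) : Prop := ∀ i < m, x.1 i = y.1 i

theorem Agree.symm {m : ℕ} {x y : B.PathSpace} (h : Agree m x y) : Agree m y x :=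
  fun i hi => (h i hi).symm

theorem Agree.trans {m : ℕ} {x y z : B.PathSpace} (h : Agree m x y) (h' : Agree m y z) :
    Agree m x z := fun i hi => (h i hi).trans (h' i hi)

theorem isOpen_agree (m : ℕ) (x : B.PathSpace) : IsOpen {y | Agree m y x} := by
  have : {y | Agree m y x} = ⋂ i ∈ Set.Iio m, {y : B.PathSpace | y.1 i ∈ ({x.1 i} : Set _)} := by
    ext y; simp [Agree]
  rw [this]
  exact (Set.finite_Iio m).isOpen_biInter fun i _ => (isClopen_coord i _).isOpen

/-- Cylinder sets form a basis of neighbourhoods. -/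
theorem exists_agree_subset {U : Set B.PathSpace} (hU : IsOpen U) {x : B.PathSpace} (hx : x ∈ U) :
    ∃ m, ∀ y, Agree m y x → y ∈ U := by
  let : ∀ n, TopologicalSpace (B.E n) := fun _ => ⊥
  have : ∀ n, DiscreteTopology (B.E n) := fun _ => ⟨rfl⟩
  obtain ⟨W, hW, rfl⟩ := isOpen_induced_iff.1 hU
  obtain ⟨I, t, ht, hsub⟩ := isOpen_pi_iff.1 hW x.1 hx
  refine ⟨I.sup id + 1, fun y hy => hsub fun i hi => ?_⟩
  exact Set.mem_of_eq_of_mem (hy i (Nat.lt_succ_of_le (Finset.le_sup (f := id) hi))) (ht i hi).2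

/-- The vertex of level `n` through which a path passes. -/
def vtx (n : ℕ) (x : B.PathSpace) : B.V n := B.s (x.1 n)

theorem r_eq_vtx (n : ℕ) (x : B.PathSpace) : B.r (x.1 n) = vtx (n + 1) x := x.2 n

end PathSpace

namespace EdgeOrder

variable {B : BratteliDiagram.{u, v}} (ω : B.EdgeOrder)

/-! ### Incoming edges indexed by their position in the order. -/

section Edges

variable {n : ℕ} {a : B.V (n + 1)}

theorem edgesInto_spec (a : B.V (n + 1)) : (∀ e, e ∈ ω.edgesInto a ↔ B.r e = a) ∧
    (ω.edgesInto a).Pairwise ω.Lt ∧ (ω.edgesInto a).length = Nat.card {e : B.E n // B.r e = a} := by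
  let : LinearOrder {e : B.E n // B.r e = a} := ω.order n a
  have : Finite (B.E n) := B.finite_E n
  let : Fintype {e : B.E n // B.r e = a} := Fintype.ofFinite _
  have hdef : ω.edgesInto a =
    ((Finset.univ : Finset {e : B.E n // B.r e = a}).sort).map Subtype.val := rfl
  rw [hdef]
  refine ⟨fun e => by simp, ?_, by simp⟩
  rw [List.pairwise_map]
  have h1 := (Finset.univ : Finset {e : B.E n // B.r e = a}).pairwise_sort (· ≤ ·)
  have h2 := (Finset.univ : Finset {e : B.E n // B.r e = a}).sort_nodup (· ≤ ·)
  refine (h1.and h2).imp ?_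
  rintro ⟨e, he⟩ ⟨f, hf⟩ ⟨hle, hne⟩
  subst hf
  exact ⟨he, lt_of_le_of_ne hle hne⟩

theorem mem_edgesInto {e : B.E n} : e ∈ ω.edgesInto a ↔ B.r e = a := (ω.edgesInto_spec a).1 e

variable {ω}

theorem Lt.range_eq {e f : B.E n} (h : ω.Lt e f) : B.r e = B.r f := h.1

theorem Lt.trans {e f g : B.E n} (h : ω.Lt e f) (h' : ω.Lt f g) : ω.Lt e g := by
  obtain ⟨h1, h2⟩ := h
  obtain ⟨h3, h4⟩ := h'
  refine ⟨h1.trans h3, ?_⟩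
  let := ω.order n (B.r g)
  have key : ∀ (a : B.V (n + 1)) (_ : a = B.r g) (h1 : B.r e = a) (hf : B.r f = a),
      (ω.order n a).lt ⟨e, h1⟩ ⟨f, hf⟩ →
      (ω.order n (B.r g)).lt ⟨e, h1.trans ‹_›⟩ ⟨f, hf.trans ‹_›⟩ := by
    rintro a rfl _ _ h; exact h
  exact lt_trans (key _ h3 h1 rfl h2) h4

theorem Lt.irrefl (e : B.E n) : ¬ ω.Lt e e := by
  rintro ⟨_, h⟩
  let := ω.order n (B.r e)
  exact lt_irrefl _ h

theorem getElem_lt_getElem {i j : ℕ} (hi : i < (ω.edgesInto a).length)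
    (hj : j < (ω.edgesInto a).length) :
    ω.Lt (ω.edgesInto a)[i] (ω.edgesInto a)[j] ↔ i < j := by
  have hp := List.pairwise_iff_getElem.1 (ω.edgesInto_spec a).2.1
  refine ⟨fun h => ?_, hp i j hi hj⟩
  by_contra hij
  rcases (not_lt.1 hij).eq_or_lt with rfl | h'
  · exact Lt.irrefl _ h
  · exact Lt.irrefl _ (h.trans (hp j i hj hi h'))

theorem exists_getElem_eq {e : B.E n} (h : B.r e = a) :
    ∃ (i : ℕ) (hi : i < (ω.edgesInto a).length), (ω.edgesInto a)[i] = e :=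
  List.mem_iff_getElem.1 (ω.mem_edgesInto.2 h)

theorem r_getElem {i : ℕ} (hi : i < (ω.edgesInto a).length) : B.r (ω.edgesInto a)[i] = a :=
  ω.mem_edgesInto.1 (List.getElem_mem hi)

theorem isMinEdge_getElem {i : ℕ} (hi : i < (ω.edgesInto a).length) :
    ω.IsMinEdge (ω.edgesInto a)[i] ↔ i = 0 := by
  constructor
  · intro h
    by_contra h0
    exact h _ ((getElem_lt_getElem (Nat.zero_lt_of_lt hi) hi).2 (Nat.pos_of_ne_zero h0))
  · rintro rfl f hf
    obtain ⟨j, hj, rfl⟩ := exists_getElem_eq (ω := ω) (hf.range_eq.trans (r_getElem hi))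
    exact absurd ((getElem_lt_getElem hj hi).1 hf) (Nat.not_lt_zero j)

theorem isMaxEdge_getElem {i : ℕ} (hi : i < (ω.edgesInto a).length) :
    ω.IsMaxEdge (ω.edgesInto a)[i] ↔ i + 1 = (ω.edgesInto a).length := by
  constructor
  · intro h
    by_contra h0
    have hi' : i + 1 < (ω.edgesInto a).length := by omega
    exact h _ ((getElem_lt_getElem hi hi').2 (Nat.lt_succ_self i))
  · rintro h f hf
    obtain ⟨j, hj, rfl⟩ := exists_getElem_eq (ω := ω) (hf.range_eq.symm.trans (r_getElem hi))
    have := (getElem_lt_getElem hi hj).1 hf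
    omega

theorem eq_of_isSucc {i : ℕ} (hi : i + 1 < (ω.edgesInto a).length) {f : B.E n}
    (h : ω.IsSucc (ω.edgesInto a)[i] f) : f = (ω.edgesInto a)[i + 1] := by
  obtain ⟨h1, h2⟩ := h
  obtain ⟨j, hj, rfl⟩ := exists_getElem_eq (ω := ω) (h1.range_eq.symm.trans (r_getElem _))
  have hij := (getElem_lt_getElem _ hj).1 h1
  have : ¬ i + 1 < j := fun h => h2 (ω.edgesInto a)[i + 1]
    ⟨(getElem_lt_getElem _ hi).2 (Nat.lt_succ_self i), (getElem_lt_getElem hi hj).2 h⟩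
  congr 1
  omega

theorem IsMinEdge.unique {e f : B.E n} (he : ω.IsMinEdge e) (hf : ω.IsMinEdge f)
    (h : B.r e = B.r f) : e = f := by
  obtain ⟨i, hi, hi'⟩ := exists_getElem_eq (ω := ω) h
  obtain ⟨j, hj, hj'⟩ := exists_getElem_eq (ω := ω) (rfl : B.r f = B.r f)
  have hi0 := (isMinEdge_getElem hi).1 (hi'.symm ▸ he)
  have hj0 := (isMinEdge_getElem hj).1 (hj'.symm ▸ hf)
  subst hi0 hj0
  exact hi'.symm.trans hj'

variable (ω) in
theorem edgesInto_length_pos (a : B.V (n + 1)) : 0 < (ω.edgesInto a).length := by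
  obtain ⟨e, he⟩ := B.r_surjective n a
  exact List.length_pos_of_mem (ω.mem_edgesInto.2 he)

end Edges

/-! ### Tower heights and minimal initial segments. -/

/-- The number of paths from the top vertex to the vertex `a`. -/
noncomputable def height : ∀ n : ℕ, B.V n → ℕ
  | 0, _ => 1
  | n + 1, a => ((ω.edgesInto a).map fun e => height n (B.s e)).sum

/-- The number of paths from the top vertex to `a` whose last edge is one of the first `i` edges
with range `a`. -/
noncomputable def partialHeight {n : ℕ} (a : B.V (n + 1)) (i : ℕ) : ℕ :=
  (((ω.edgesInto a).take i).map fun e => ω.height n (B.s e)).sum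

theorem partialHeight_zero {n : ℕ} (a : B.V (n + 1)) : ω.partialHeight a 0 = 0 := by
  simp [partialHeight]

theorem partialHeight_succ {n : ℕ} (a : B.V (n + 1)) {i : ℕ} (hi : i < (ω.edgesInto a).length) :
    ω.partialHeight a (i + 1) =
      ω.partialHeight a i + ω.height n (B.s (ω.edgesInto a)[i]) := by
  rw [partialHeight, partialHeight, List.take_add_one, List.getElem?_eq_getElem hi,
    List.map_append, List.sum_append]
  simp only [Option.toList_some, List.map_cons, List.map_nil, List.sum_cons, List.sum_nil,
    add_zero]

theorem partialHeight_length {n : ℕ} (a : B.V (n + 1)) :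
    ω.partialHeight a (ω.edgesInto a).length = ω.height (n + 1) a := by
  rw [partialHeight, List.take_length, height]

/-- Floor `j` of the tower over `a` is floor `t` of the `i`-th tower of level `n` in the stack. -/
theorem exists_partialHeight_add {n : ℕ} (a : B.V (n + 1)) (j : ℕ) (hj : j < ω.height (n + 1) a) :
    ∃ (i : ℕ) (hi : i < (ω.edgesInto a).length) (t : ℕ),
      t < ω.height n (B.s (ω.edgesInto a)[i]) ∧ j = ω.partialHeight a i + t := by
  have key : ∀ l ≤ (ω.edgesInto a).length, j < ω.partialHeight a l →
      ∃ (i : ℕ) (hi : i < (ω.edgesInto a).length) (t : ℕ),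
        t < ω.height n (B.s (ω.edgesInto a)[i]) ∧ j = ω.partialHeight a i + t := by
    intro l
    induction l with
    | zero => intro _ h; simp [partialHeight_zero] at h
    | succ l ih =>
      intro hl h
      by_cases h' : j < ω.partialHeight a l
      · exact ih (by omega) h'
      · rw [ω.partialHeight_succ a (by omega : l < _)] at h
        exact ⟨l, by omega, j - ω.partialHeight a l, by omega, by omega⟩
  exact key _ le_rfl (by rwa [partialHeight_length])

/-- The paths whose first `n` edges are minimal. -/
def minBelow (n : ℕ) : Set B.PathSpace := {z | ∀ j < n, ω.IsMinEdge (z.1 j)}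

variable {ω}

/-- A vertex has only one minimal incoming edge, so a minimal initial segment is determined by its
end vertex, read downwards. -/
theorem minBelow_agree {n : ℕ} {z z' : B.PathSpace} (hz : z ∈ ω.minBelow n)
    (hz' : z' ∈ ω.minBelow n) (h : vtx n z = vtx n z') : Agree n z z' := by
  induction n with
  | zero => intro i hi; omega
  | succ n ih =>
    have hn : z.1 n = z'.1 n := IsMinEdge.unique (hz n (Nat.lt_succ_self n))
      (hz' n (Nat.lt_succ_self n)) (by rw [r_eq_vtx, r_eq_vtx, h])
    intro i hi
    rcases Nat.lt_succ_iff_lt_or_eq.1 hi with h' | rfl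
    · exact ih (fun j hj => hz j (by omega)) (fun j hj => hz' j (by omega))
        (by simp only [vtx, hn]) i h'
    · exact hn

/-- Every edge is the last one of a finite path all of whose other edges are minimal. -/
theorem exists_min_prefix (n : ℕ) (e : B.E n) : ∃ p : ∀ i, B.E i, p n = e ∧
    ∀ i < n, ω.IsMinEdge (p i) ∧ B.r (p i) = B.s (p (i + 1)) := by
  classical
  induction n with
  | zero =>
    exact ⟨Function.update (fun i => (B.nonempty_E i).some) 0 e, by simp, fun i hi => by omega⟩
  | succ n ih =>
    have h0 := ω.edgesInto_length_pos (B.s e)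
    obtain ⟨p, hp, hp'⟩ := ih (ω.edgesInto (B.s e))[0]
    refine ⟨Function.update p (n + 1) e, by simp, fun i hi => ?_⟩
    rcases Nat.lt_succ_iff_lt_or_eq.1 hi with h' | rfl
    · rw [Function.update_of_ne (by omega), Function.update_of_ne (by omega)]
      exact hp' i h'
    · rw [Function.update_of_ne (by omega), Function.update_self, hp]
      exact ⟨(isMinEdge_getElem h0).2 rfl, r_getElem h0⟩

/-- Any path can be modified before level `n` and, keeping the range, in its `n`-th edge. -/
theorem exists_path_through (n : ℕ) (x : B.PathSpace) (e : B.E n) (he : B.r e = B.r (x.1 n)) :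
    ∃ z ∈ ω.minBelow n, z.1 n = e ∧ ∀ i, n < i → z.1 i = x.1 i := by
  obtain ⟨p, hp, hp'⟩ := exists_min_prefix (ω := ω) n e
  refine ⟨⟨fun i => if i ≤ n then p i else x.1 i, fun i => ?_⟩, fun i hi => ?_, ?_, fun i hi => ?_⟩
  · change B.r (if i ≤ n then p i else x.1 i) = B.s (if i + 1 ≤ n then p (i + 1) else x.1 (i + 1))
    rcases lt_trichotomy i n with h | rfl | h
    · rw [if_pos h.le, if_pos (Nat.succ_le_of_lt h)]
      exact (hp' i h).2
    · rw [if_pos le_rfl, if_neg (by omega), hp, he]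
      exact x.2 i
    · rw [if_neg (by omega), if_neg (by omega)]
      exact x.2 i
  · simpa [hi.le] using (hp' i hi).1
  · simpa using hp
  · simp [hi]

theorem exists_minBelow_tail (n : ℕ) (x : B.PathSpace) :
    ∃ z ∈ ω.minBelow n, ∀ i, n ≤ i → z.1 i = x.1 i := by
  obtain ⟨z, hz, h1, h2⟩ := exists_path_through (ω := ω) n x (x.1 n) rfl
  refine ⟨z, hz, fun i hi => ?_⟩
  rcases hi.eq_or_lt with rfl | h
  · exact h1
  · exact h2 i h

/-- Compactness: the sets `minBelow n` are nonempty, closed and decreasing. -/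
theorem minPaths_nonempty : ω.minPaths.Nonempty := by
  have hclosed : ∀ n, IsClosed (ω.minBelow n) := fun n => by
    have : ω.minBelow n = ⋂ i ∈ Set.Iio n, {z : B.PathSpace | z.1 i ∈ {e | ω.IsMinEdge e}} := by
      ext z; simp [minBelow]
    rw [this]
    exact isClosed_biInter fun i _ => (isClopen_coord i _).isClosed
  obtain ⟨z, hz⟩ := IsCompact.nonempty_iInter_of_sequence_nonempty_isCompact_isClosed ω.minBelow
    (fun n z hz j hj => hz j (by omega))
    (fun n => by
      obtain ⟨z, hz, -⟩ := exists_minBelow_tail (ω := ω) n (Classical.arbitrary B.PathSpace)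
      exact ⟨z, hz⟩) (hclosed 0).isCompact hclosed
  exact ⟨z, fun n => Set.mem_iInter.1 hz (n + 1) n (Nat.lt_succ_self n)⟩

/-! ### The Vershik map on the towers. -/

section Vershik

variable {φ : B.PathSpace ≃ₜ B.PathSpace}

/-- At the top floor all edges before `n` are maximal while edge `n` is not, so the next step of `φ`
moves edge `n` to its successor and resets the edges before it. -/
theorem tower_step (hφ : ω.IsVershikMap φ) {n : ℕ} {z y : B.PathSpace}
    (hlast : ∃ t, t + 1 = ω.height n (vtx n y) ∧ (∀ j < n, ω.IsMaxEdge (((φ ^ t) y).1 j)) ∧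
      ∀ j, n ≤ j → ((φ ^ t) y).1 j = y.1 j) {i : ℕ}
    (hi : i + 1 < (ω.edgesInto (B.r (z.1 n))).length)
    (hy : y.1 n = (ω.edgesInto (B.r (z.1 n)))[i]) :
    let y' := (φ ^ ω.height n (vtx n y)) y
    y' ∈ ω.minBelow n ∧ y'.1 n = (ω.edgesInto (B.r (z.1 n)))[i + 1] ∧
      ∀ j, n < j → y'.1 j = y.1 j := by
  obtain ⟨t, ht, hmax, htail⟩ := hlast
  have hn : ((φ ^ t) y).1 n = (ω.edgesInto (B.r (z.1 n)))[i] := (htail n le_rfl).trans hy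
  obtain ⟨h1, h2, h3⟩ := hφ.map_of_not_max ((φ ^ t) y) n hmax (by
    rw [hn, isMaxEdge_getElem]; omega)
  rw [hn] at h2
  intro y'
  have hy' : y' = φ ((φ ^ t) y) := by
    simp only [y', ← ht, pow_succ', Homeomorph.mul_apply]
  rw [hy']
  exact ⟨h1, eq_of_isSucc hi h2, fun j hj => (h3 j hj).trans (htail j hj.le)⟩

/-- `hlast` is `tower_last` at level `n`, kept as a hypothesis because the inductive step of
`tower_last` relies on this lemma. -/
theorem tower_decomp_of_last (hφ : ω.IsVershikMap φ) {n : ℕ}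
    (hlast : ∀ y ∈ ω.minBelow n, ∃ t, t + 1 = ω.height n (vtx n y) ∧
      (∀ j < n, ω.IsMaxEdge (((φ ^ t) y).1 j)) ∧ ∀ j, n ≤ j → ((φ ^ t) y).1 j = y.1 j)
    {z : B.PathSpace} (hz : z ∈ ω.minBelow (n + 1)) {i : ℕ}
    (hi : i < (ω.edgesInto (B.r (z.1 n))).length) :
    let y := (φ ^ ω.partialHeight (B.r (z.1 n)) i) z
    y ∈ ω.minBelow n ∧ y.1 n = (ω.edgesInto (B.r (z.1 n)))[i] ∧ ∀ j, n < j → y.1 j = z.1 j := by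
  induction i with
  | zero =>
    rw [partialHeight_zero]
    refine ⟨fun j hj => hz j (by omega), ?_, fun j _ => rfl⟩
    obtain ⟨i, hi', h⟩ := exists_getElem_eq (ω := ω) (rfl : B.r (z.1 n) = _)
    have := hz n (Nat.lt_succ_self n)
    rw [← h, isMinEdge_getElem] at this
    subst this
    exact h.symm
  | succ i ih =>
    obtain ⟨h1, h2, h3⟩ := ih (by omega)
    obtain ⟨h4, h5, h6⟩ := tower_step hφ (z := z) (hlast _ h1) hi h2
    have : ω.partialHeight (B.r (z.1 n)) (i + 1) =
        ω.height n (vtx n ((φ ^ ω.partialHeight (B.r (z.1 n)) i) z)) +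
          ω.partialHeight (B.r (z.1 n)) i := by
      rw [ω.partialHeight_succ _ (by omega : i < _), vtx, h2, add_comm]
    rw [this, pow_add]
    exact ⟨h4, h5, fun j hj => (h6 j hj).trans (h3 j hj)⟩

/-- The last point over `z` of the tower of level `n`. -/
theorem tower_last (hφ : ω.IsVershikMap φ) (n : ℕ) : ∀ z ∈ ω.minBelow n,
    ∃ t, t + 1 = ω.height n (vtx n z) ∧ (∀ j < n, ω.IsMaxEdge (((φ ^ t) z).1 j)) ∧
      ∀ j, n ≤ j → ((φ ^ t) z).1 j = z.1 j := by
  induction n with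
  | zero => exact fun z _ => ⟨0, rfl, fun j hj => absurd hj (Nat.not_lt_zero j), fun j _ => rfl⟩
  | succ n ih =>
    intro z hz
    obtain ⟨l, hl⟩ : ∃ l, (ω.edgesInto (B.r (z.1 n))).length = l + 1 :=
      Nat.exists_eq_succ_of_ne_zero (ω.edgesInto_length_pos _).ne'
    have hl' : l < (ω.edgesInto (B.r (z.1 n))).length := by omega
    obtain ⟨h1, h2, h3⟩ := tower_decomp_of_last hφ ih hz hl'
    obtain ⟨t, ht, h4, h5⟩ := ih _ h1
    refine ⟨t + ω.partialHeight (B.r (z.1 n)) l, ?_, ?_, ?_⟩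
    · rw [← r_eq_vtx, ← partialHeight_length, hl, ω.partialHeight_succ _ hl']
      rw [vtx, h2] at ht
      omega
    · intro j hj
      rw [pow_add, Homeomorph.mul_apply]
      rcases Nat.lt_succ_iff_lt_or_eq.1 hj with h' | rfl
      · exact h4 j h'
      · rw [h5 j le_rfl, h2, isMaxEdge_getElem, hl]
    · intro j hj
      rw [pow_add, Homeomorph.mul_apply]
      exact (h5 j (by omega)).trans (h3 j hj)

theorem tower_decomp (hφ : ω.IsVershikMap φ) {n : ℕ} {z : B.PathSpace}
    (hz : z ∈ ω.minBelow (n + 1)) {i : ℕ} (hi : i < (ω.edgesInto (B.r (z.1 n))).length) :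
    let y := (φ ^ ω.partialHeight (B.r (z.1 n)) i) z
    y ∈ ω.minBelow n ∧ y.1 n = (ω.edgesInto (B.r (z.1 n)))[i] ∧ ∀ j, n < j → y.1 j = z.1 j :=
  tower_decomp_of_last hφ (tower_last hφ n) hz hi

theorem height_pos (hφ : ω.IsVershikMap φ) {n : ℕ} {z : B.PathSpace} (hz : z ∈ ω.minBelow n) :
    0 < ω.height n (vtx n z) := by
  obtain ⟨t, ht, -⟩ := tower_last hφ n z hz
  omega

/-- Going once through the tower of level `n` leads back to its base. -/
theorem tower_return (hφ : ω.IsVershikMap φ) {n : ℕ} {z : B.PathSpace} (hz : z ∈ ω.minBelow n) :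
    (φ ^ ω.height n (vtx n z)) z ∈ ω.minBelow n := by
  classical
  obtain ⟨t, ht, h1, -⟩ := tower_last hφ n z hz
  rw [← ht, pow_succ', Homeomorph.mul_apply]
  by_cases h : ∃ k, ¬ ω.IsMaxEdge (((φ ^ t) z).1 k)
  · have h2 := (hφ.map_of_not_max _ (Nat.find h)
      (fun j hj => not_not.1 (Nat.find_min h hj)) (Nat.find_spec h)).1
    have h3 : n ≤ Nat.find h := by
      by_contra h'
      exact Nat.find_spec h (h1 _ (not_le.1 h'))
    exact fun j hj => h2 j (hj.trans_le h3)
  -- The top point is a maximal path. The successor rule does not apply, and `image_maxPaths` brings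
  -- it back to the base.
  · have : φ ((φ ^ t) z) ∈ ω.minPaths := by
      rw [← hφ.image_maxPaths]
      exact ⟨_, fun n => not_not.1 fun h' => h ⟨n, h'⟩, rfl⟩
    exact fun j _ => this j

/-- While the orbit climbs one tower of level `n`, no carry reaches edge `n`. -/
theorem tower_tail (hφ : ω.IsVershikMap φ) {n : ℕ} : ∀ {z : B.PathSpace}, z ∈ ω.minBelow n →
    ∀ {j : ℕ}, j < ω.height n (vtx n z) → ∀ i, n ≤ i → ((φ ^ j) z).1 i = z.1 i := by
  induction n with
  | zero =>
    intro z _ j hj i _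
    obtain rfl : j = 0 := by simpa [height] using hj
    rfl
  | succ n ih =>
    intro z hz j hj i hi
    rw [← r_eq_vtx] at hj
    obtain ⟨k, hk, t, ht, rfl⟩ := ω.exists_partialHeight_add _ j hj
    obtain ⟨h1, h2, h3⟩ := tower_decomp hφ hz hk
    rw [add_comm (ω.partialHeight _ _), pow_add, Homeomorph.mul_apply,
      ih h1 (by rwa [vtx, h2]) i (by omega), h3 i (by omega)]

/-- Two points of the base of the same tower of level `n` move in parallel. -/
theorem tower_agree (hφ : ω.IsVershikMap φ) {n : ℕ} : ∀ {z z' : B.PathSpace},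
    z ∈ ω.minBelow n → z' ∈ ω.minBelow n → vtx n z = vtx n z' →
    ∀ {j : ℕ}, j < ω.height n (vtx n z) → Agree n ((φ ^ j) z) ((φ ^ j) z') := by
  induction n with
  | zero => intro z z' _ _ _ j _ i hi; omega
  | succ n ih =>
    intro z z' hz hz' h j hj
    rw [← r_eq_vtx] at hj
    obtain ⟨k, hk, t, ht, rfl⟩ := ω.exists_partialHeight_add _ j hj
    have hr : z.1 n = z'.1 n := minBelow_agree hz hz' h n (Nat.lt_succ_self n)
    obtain ⟨h1, h2, -⟩ := tower_decomp hφ hz hk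
    have hd' := tower_decomp hφ hz' (i := k) (by rwa [← hr])
    simp only [← hr] at hd'
    obtain ⟨h1', h2', -⟩ := hd'
    have hv := congrArg B.s (h2.trans h2'.symm)
    have ht1 := ht
    rw [← h2] at ht
    have ht' := ht1
    rw [← h2'] at ht'
    rw [add_comm (ω.partialHeight _ _), pow_add, Homeomorph.mul_apply, Homeomorph.mul_apply]
    intro i hi
    rcases Nat.lt_succ_iff_lt_or_eq.1 hi with h' | rfl
    · exact ih h1 h1' hv ht i h'
    · rw [tower_tail hφ h1 ht i le_rfl, tower_tail hφ h1' ht' i le_rfl, h2, h2']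

/-- Every path that agrees with `z` after level `n` lies over `z` in the tower of level `n`. -/
theorem tower_cover (hφ : ω.IsVershikMap φ) {n : ℕ} : ∀ {z x : B.PathSpace}, z ∈ ω.minBelow n →
    (∀ i, n ≤ i → x.1 i = z.1 i) → ∃ j, x = (φ ^ j) z := by
  induction n with
  | zero => exact fun {z x} _ h => ⟨0, Subtype.ext (funext fun i => h i (Nat.zero_le i))⟩
  | succ n ih =>
    intro z x hz h
    have hr : B.r (x.1 n) = B.r (z.1 n) := by
      rw [r_eq_vtx, r_eq_vtx, vtx, vtx, h (n + 1) le_rfl]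
    obtain ⟨k, hk, hk'⟩ := exists_getElem_eq (ω := ω) hr
    obtain ⟨h1, h2, h3⟩ := tower_decomp hφ hz hk
    obtain ⟨j, hj⟩ := ih (x := x) h1 fun i hi => by
      rcases hi.eq_or_lt with rfl | h'
      · rw [h2, hk']
      · rw [h i h', h3 i h']
    exact ⟨j + ω.partialHeight (B.r (z.1 n)) k, by rw [pow_add, Homeomorph.mul_apply, ← hj]⟩

end Vershik

end EdgeOrder

end BratteliDiagram

/-! ### Periods of words. -/

theorem List.hasPeriod_flatten_replicate {α : Type*} (U : List α) (k : ℕ) :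
    (List.replicate k U).flatten.HasPeriod U.length := by
  cases k with
  | zero => simp [List.HasPeriod]
  | succ k =>
    have h : (List.replicate k U).flatten <+: (List.replicate (k + 1) U).flatten := by
      rw [List.replicate_succ', List.flatten_append]
      exact List.prefix_append _ _
    rw [List.HasPeriod, List.replicate_succ, List.flatten_cons, List.take_left,
      List.prefix_append_right_inj]
    rwa [List.replicate_succ, List.flatten_cons] at h

/-- Every word of a periodic language has the length of the generating word as a period. -/
theorem IsPeriodicLanguage.exists_hasPeriod {A : Type w} {L : Set (List A)}
    (h : IsPeriodicLanguage L) (hL : ∃ W ∈ L, W ≠ []) :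
    ∃ p, 0 < p ∧ ∀ W ∈ L, W.HasPeriod p := by
  obtain ⟨U, -, hU⟩ := h
  refine ⟨U.length, List.length_pos_of_ne_nil ?_, fun W hW => ?_⟩
  · rintro rfl
    obtain ⟨W, hW, hne⟩ := hL
    rcases hU W hW with ⟨S, P, k, hS, hP, rfl⟩ | h
    · simp [List.suffix_nil.1 hS, List.prefix_nil.1 hP] at hne
    · exact hne (List.infix_nil.1 h)
  · rcases hU W hW with ⟨S, P, k, ⟨S', hS⟩, ⟨P', hP⟩, rfl⟩ | h
    -- Completing `S` and `P` to full copies of `U` puts `S U ^ k P` inside `U ^ (k + 2)`.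
    · refine (List.hasPeriod_flatten_replicate U (k + 2)).infix ⟨S', P', ?_⟩
      calc S' ++ (S ++ (List.replicate k U).flatten ++ P) ++ P'
          = (S' ++ S) ++ (List.replicate k U).flatten ++ (P ++ P') := by simp
        _ = (List.replicate (k + 2) U).flatten := by
          rw [hS, hP, List.replicate_succ, List.replicate_succ', List.flatten_cons,
            List.flatten_append, List.flatten_singleton, List.append_assoc]
    · exact List.hasPeriod_of_length_le _ _ h.length_le

/-! ### Splicing paths, and minimality of the Vershik map. -/

namespace BratteliDiagram

variable {B : BratteliDiagram.{u, v}} {A : Type w}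

/-- Two paths through the same vertex of level `m` can be spliced at that vertex. -/
theorem exists_splice {m : ℕ} {x z : B.PathSpace} (h : vtx m x = vtx m z) :
    ∃ y, Agree m y x ∧ ∀ i, m ≤ i → y.1 i = z.1 i := by
  refine ⟨⟨fun i => if i < m then x.1 i else z.1 i, fun i => ?_⟩, fun i hi => ?_, fun i hi => ?_⟩
  · change B.r (if i < m then x.1 i else z.1 i) = B.s (if i + 1 < m then x.1 (i + 1) else z.1 (i + 1))
    rcases lt_trichotomy (i + 1) m with h' | rfl | h'
    · rw [if_pos (by omega), if_pos h']
      exact x.2 i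
    · rw [if_pos (Nat.lt_succ_self i), if_neg (lt_irrefl _)]
      exact (x.2 i).trans h
    · rw [if_neg (by omega), if_neg (by omega)]
      exact z.2 i
  · exact if_pos hi
  · exact if_neg (not_lt.2 hi)

namespace EdgeOrder

variable {ω : B.EdgeOrder}

theorem exists_splice_of_connected (ω : B.EdgeOrder) {m : ℕ} {x : B.PathSpace} (k : ℕ) :
    ∀ {z : B.PathSpace}, B.Connected m k (vtx m x) (vtx (m + k) z) →
      ∃ y, Agree m y x ∧ ∀ i, m + k ≤ i → y.1 i = z.1 i := by
  induction k with
  | zero => exact fun {z} h => exists_splice h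
  | succ k ih =>
    rintro z ⟨e, he, h⟩
    obtain ⟨z', -, h1, h2⟩ := exists_path_through (ω := ω) (m + k) z e
      (he.trans (r_eq_vtx (m + k) z).symm)
    have h' : B.Connected m k (vtx m x) (vtx (m + k) z') := by
      rwa [show vtx (m + k) z' = B.s e from congrArg B.s h1]
    obtain ⟨y, h3, h4⟩ := ih h'
    exact ⟨y, h3, fun i hi => (h4 i (by omega)).trans (h2 i (by omega))⟩

section Minimality

variable {φ : B.PathSpace ≃ₜ B.PathSpace}

/-- The forward orbit of a minimal path meets every cylinder set. -/
theorem exists_pow_agree (hsimple : B.IsSimple) (hφ : ω.IsVershikMap φ) {z : B.PathSpace}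
    (hz : z ∈ ω.minPaths) (m : ℕ) (x : B.PathSpace) : ∃ j : ℕ, Agree m ((φ ^ j) z) x := by
  obtain ⟨k, -, hk⟩ := hsimple m
  obtain ⟨y, h1, h2⟩ := exists_splice_of_connected ω k (hk (vtx m x) (vtx (m + k) z))
  obtain ⟨j, rfl⟩ := tower_cover hφ (n := m + k) (fun i _ => hz i) h2
  exact ⟨j, h1⟩

theorem isMinimalSystem (hsimple : B.IsSimple) (hφ : ω.IsVershikMap φ) : IsMinimalSystem φ := by
  intro y
  rw [dense_iff_inter_open]
  rintro U hU ⟨x, hx⟩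
  obtain ⟨m, hm⟩ := exists_agree_subset hU hx
  obtain ⟨k, -, hk⟩ := hsimple m
  obtain ⟨y', h1, h2⟩ := exists_splice_of_connected ω k (hk (vtx m x) (vtx (m + k) y))
  obtain ⟨z, hz, hzy⟩ := exists_minBelow_tail (ω := ω) (m + k) y
  -- `y` and `y'` have the same tail, so they are floors over the same base point `z` and lie in one
  -- orbit.
  obtain ⟨i, rfl⟩ := tower_cover hφ hz (x := y) fun i hi => (hzy i hi).symm
  obtain ⟨j, rfl⟩ := tower_cover hφ hz (x := y') fun i hi => (h2 i hi).trans (hzy i hi).symm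
  refine ⟨_, hm _ h1, (j : ℤ) - i, ?_⟩
  simp only [← zpow_natCast, ← Homeomorph.mul_apply, ← zpow_add, sub_add_cancel]

end Minimality

/-! ### Itineraries through towers, and periodicity of the cylinders. -/

section Itinerary

variable {m : ℕ}

/-- Each level at least doubles the length. The bound ensures that any number of steps of an
itinerary can be read off a single word. -/
theorem length_sources {lab : ∀ n, B.V (n + 1) ≃ A} {d : ℕ} (hrank : B.IsStrictRank lab d)
    (m k : ℕ) : ∀ a : B.V (m + k), k < (ω.sources m k a).length := by
  induction k with
  | zero => intro a; simp [sources]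
  | succ k ih =>
    intro a
    have h2 : 2 ≤ (ω.edgesInto (n := m + k) a).length := by
      rw [(ω.edgesInto_spec (n := m + k) a).2.2]
      exact hrank.two_le (m + k) a
    change k + 1 < ((ω.edgesInto (n := m + k) a).flatMap fun e => ω.sources m k (B.s e)).length
    obtain ⟨e, f, l, hl⟩ : ∃ e f l, ω.edgesInto (n := m + k) a = e :: f :: l := by
      match h : ω.edgesInto (n := m + k) a, h2 with
      | e :: f :: l, _ => exact ⟨e, f, l, rfl⟩
    rw [hl]
    simp only [List.flatMap_cons, List.length_append]
    have := ih (B.s e)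
    have := ih (B.s f)
    omega

variable (ω) in
/-- The return map to the base of the towers of level `m`. -/
noncomputable def returnMap (φ : B.PathSpace ≃ₜ B.PathSpace) (m : ℕ) (z : B.PathSpace) :
    B.PathSpace := (φ ^ ω.height m (vtx m z)) z

variable (ω) in
/-- Starting at `z`, the towers of level `m` visited up to the arrival at `z'` are those in `L`. -/
def Walk (φ : B.PathSpace ≃ₜ B.PathSpace) (m : ℕ) (z : B.PathSpace) (L : List (B.V m))
    (z' : B.PathSpace) : Prop :=
  (ω.returnMap φ m)^[L.length] z = z' ∧
    ∀ i < L.length, L[i]? = some (vtx m ((ω.returnMap φ m)^[i] z))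

variable {φ : B.PathSpace ≃ₜ B.PathSpace}

theorem Walk.append {z z' z'' : B.PathSpace} {L L' : List (B.V m)} (h : ω.Walk φ m z L z')
    (h' : ω.Walk φ m z' L' z'') : ω.Walk φ m z (L ++ L') z'' := by
  refine ⟨?_, fun i hi => ?_⟩
  · rw [List.length_append, add_comm, Function.iterate_add_apply, h.1, h'.1]
  · by_cases hlt : i < L.length
    · rw [List.getElem?_append_left hlt, h.2 i hlt]
    · rw [not_lt] at hlt
      rw [List.length_append] at hi
      rw [List.getElem?_append_right hlt, h'.2 _ (by omega), ← h.1, ← Function.iterate_add_apply,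
        Nat.sub_add_cancel hlt]

/-- The itinerary from the base of the tower `a` of level `m + k`, in terms of the towers of
level `m`, is the list of the sources of the paths from level `m` to `a`. -/
theorem walk_sources (hφ : ω.IsVershikMap φ) (k : ℕ) : ∀ {z : B.PathSpace},
    z ∈ ω.minBelow (m + k) →
      ω.Walk φ m z (ω.sources m k (vtx (m + k) z)) (ω.returnMap φ (m + k) z) := by
  induction k with
  | zero =>
    refine fun {z} _ => ⟨rfl, fun i hi => ?_⟩
    obtain rfl : i = 0 := by simpa [sources] using hi
    rfl
  | succ k ih =>
    intro z hz
    -- Itinerary through the first `i` towers of level `m + k` in the stack.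
    have key : ∀ i ≤ (ω.edgesInto (B.r (z.1 (m + k)))).length,
        ω.Walk φ m z (((ω.edgesInto (B.r (z.1 (m + k)))).take i).flatMap
          fun e => ω.sources m k (B.s e)) ((φ ^ ω.partialHeight (B.r (z.1 (m + k))) i) z) := by
      intro i
      induction i with
      | zero =>
        intro _
        rw [partialHeight_zero]
        exact ⟨rfl, fun i hi => absurd hi (Nat.not_lt_zero i)⟩
      | succ i ihi =>
        intro hi
        obtain ⟨h1, h2, -⟩ := tower_decomp hφ (n := m + k) hz (Nat.lt_of_succ_le hi)
        have h3 := ih h1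
        have hv : vtx (m + k) ((φ ^ ω.partialHeight (B.r (z.1 (m + k))) i) z) =
            B.s (ω.edgesInto (B.r (z.1 (m + k))))[i] := congrArg B.s h2
        rw [returnMap, hv, ← Homeomorph.mul_apply, ← pow_add,
          add_comm (ω.height _ _), ← ω.partialHeight_succ _ (Nat.lt_of_succ_le hi)] at h3
        rw [List.take_add_one, List.getElem?_eq_getElem (Nat.lt_of_succ_le hi),
          List.flatMap_append]
        refine (ihi (by omega)).append ?_
        simpa only [Option.toList_some, List.flatMap_cons, List.flatMap_nil, List.append_nil]
          using h3
    have h := key _ le_rfl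
    rw [List.take_length, partialHeight_length, r_eq_vtx] at h
    exact h

variable (ω) in
/-- The list `L` occurs among the sources at level `m` of the paths to the vertex `b`. -/
def Occurs (L : List (B.V m)) (N : ℕ) (b : B.V N) : Prop :=
  ∃ (j : ℕ) (h : m + j = N), L <:+: ω.sources m j (h ▸ b)

theorem Occurs.step {L : List (B.V m)} {N : ℕ} {e : B.E N} (h : ω.Occurs L N (B.s e)) :
    ω.Occurs L (N + 1) (B.r e) := by
  obtain ⟨j, rfl, h⟩ := h
  exact ⟨j + 1, rfl, h.trans (List.infix_of_mem_flatten
    (List.mem_map_of_mem (f := fun e => ω.sources m j (B.s e)) (ω.mem_edgesInto.2 rfl)))⟩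

theorem Occurs.of_connected {L : List (B.V m)} {N : ℕ} {a : B.V N} (h : ω.Occurs L N a) (k : ℕ) :
    ∀ b : B.V (N + k), B.Connected N k a b → ω.Occurs L (N + k) b := by
  induction k with
  | zero => rintro b rfl; exact h
  | succ k ih =>
    rintro b ⟨e, rfl, he⟩
    exact (ih _ he).step

/-- Simplicity puts the word below every vertex of one level. It persists at all later levels, since
every vertex there has an incoming edge. -/
theorem eventually_occurs (hsimple : B.IsSimple) (k : ℕ) (a : B.V (m + k)) :
    ∀ᶠ N in atTop, ∀ b : B.V N, ω.Occurs (ω.sources m k a) N b := by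
  obtain ⟨k', -, hk'⟩ := hsimple (m + k)
  refine eventually_atTop.2 ⟨m + k + k', fun N hN => ?_⟩
  induction N, hN using Nat.le_induction with
  | base => exact fun b => Occurs.of_connected ⟨k, rfl, List.infix_rfl⟩ k' b (hk' a b)
  | succ N _ ih =>
    intro b
    obtain ⟨e, rfl⟩ := B.r_surjective N b
    exact (ih _).step

theorem word_mem_language (hsimple : B.IsSimple) {A : Type w} (lab : ∀ n, B.V (n + 1) ≃ A)
    (m k : ℕ) (a : B.V (m + 1 + k)) : ω.word lab m k a ∈ ω.language lab := by
  refine Eventually.frequently ?_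
  filter_upwards [eventually_occurs (ω := ω) hsimple k a, eventually_gt_atTop (m + 1)] with N hN hm
  obtain ⟨b⟩ := B.nonempty_V N
  obtain ⟨j, rfl, hj⟩ := hN b
  exact ⟨m, j, b, by omega, rfl, hj.map _⟩

/-- If all words have a period `p`, then so has the itinerary of a minimal path. -/
theorem vtx_iterate_add_period {lab : ∀ n, B.V (n + 1) ≃ A} {d : ℕ}
    (hrank : B.IsStrictRank lab d) (hφ : ω.IsVershikMap φ) {p : ℕ}
    (hp : ∀ k a, (ω.word lab m k a).HasPeriod p) {z : B.PathSpace} (hz : z ∈ ω.minPaths) (i : ℕ) :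
    vtx (m + 1) ((ω.returnMap φ (m + 1))^[i + p] z) =
      vtx (m + 1) ((ω.returnMap φ (m + 1))^[i] z) := by
  -- This level is high enough for the word of `a` to have length more than `i + p`.
  set a := vtx (m + 1 + (i + p)) z with ha
  have hlen := length_sources (ω := ω) hrank (m + 1) (i + p) a
  obtain ⟨-, hw⟩ := walk_sources (m := m + 1) hφ (i + p) (z := z) (fun j _ => hz j)
  have h1 := hw i (by rw [← ha]; omega)
  have h2 := hw (i + p) (by rw [← ha]; omega)
  rw [← ha] at h1 h2
  have h := List.hasPeriod_iff_getElem?.1 (hp (i + p) a) i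
    (by simp only [word, List.length_map]; omega)
  rw [word, List.getElem?_map, List.getElem?_map, h1, h2] at h
  simpa using h.symm

theorem iterate_returnMap_mem (hφ : ω.IsVershikMap φ) {z : B.PathSpace} (hz : z ∈ ω.minBelow m)
    (i : ℕ) : (ω.returnMap φ m)^[i] z ∈ ω.minBelow m := by
  induction i with
  | zero => exact hz
  | succ i ih =>
    rw [Function.iterate_succ_apply']
    exact tower_return hφ ih

variable (ω) in
/-- The time of the `i`-th return of `z` to the base of the towers of level `m`. -/
noncomputable def returnTime (φ : B.PathSpace ≃ₜ B.PathSpace) (m : ℕ) (z : B.PathSpace) (i : ℕ) : ℕ :=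
  ∑ j ∈ Finset.range i, ω.height m (vtx m ((ω.returnMap φ m)^[j] z))

theorem pow_returnTime (z : B.PathSpace) (i : ℕ) :
    (φ ^ ω.returnTime φ m z i) z = (ω.returnMap φ m)^[i] z := by
  induction i with
  | zero => rfl
  | succ i ih =>
    rw [Function.iterate_succ_apply', ← ih, returnMap, ← Homeomorph.mul_apply, ← pow_add, ih,
      returnTime, Finset.sum_range_succ, add_comm]
    rfl

theorem exists_returnTime_add (hφ : ω.IsVershikMap φ) {z : B.PathSpace} (hz : z ∈ ω.minBelow m)
    (s : ℕ) : ∃ i j, j < ω.height m (vtx m ((ω.returnMap φ m)^[i] z)) ∧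
      s = ω.returnTime φ m z i + j := by
  induction s with
  | zero => exact ⟨0, 0, height_pos hφ hz, rfl⟩
  | succ s ih =>
    obtain ⟨i, j, hj, rfl⟩ := ih
    rcases (Nat.succ_le_of_lt hj).eq_or_lt with h | h
    · refine ⟨i + 1, 0, height_pos hφ (iterate_returnMap_mem hφ hz _), ?_⟩
      rw [returnTime, returnTime, Finset.sum_range_succ]
      omega
    · exact ⟨i, j + 1, h, rfl⟩

/-- If the words at level `m + 1` have a common period, then some positive power of the Vershik map
preserves all cylinder sets of length `m + 1`. -/
theorem exists_pow_agree_self (hsimple : B.IsSimple) {lab : ∀ n, B.V (n + 1) ≃ A} {d : ℕ}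
    (hrank : B.IsStrictRank lab d) (hφ : ω.IsVershikMap φ) {p : ℕ} (hp0 : 0 < p)
    (hp : ∀ k a, (ω.word lab m k a).HasPeriod p) :
    ∃ H : ℕ, 0 < H ∧ ∀ x, Agree (m + 1) ((φ ^ H) x) x := by
  obtain ⟨z, hz⟩ := minPaths_nonempty (ω := ω)
  have hz' : z ∈ ω.minBelow (m + 1) := fun j _ => hz j
  have hper := vtx_iterate_add_period hrank hφ hp hz
  -- The exponent sought is `t p`, the total height of `p` consecutive towers.
  set t := ω.returnTime φ (m + 1) z with ht
  have htime : ∀ i, t (i + p) = t i + t p := by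
    intro i
    induction i with
    | zero => simp [ht, returnTime]
    | succ i ih =>
      rw [add_right_comm]
      simp only [ht, returnTime, Finset.sum_range_succ] at ih ⊢
      rw [ih, hper]
      omega
  refine ⟨t p, ?_, fun x => ?_⟩
  · refine Finset.sum_pos (fun i _ => height_pos hφ (iterate_returnMap_mem hφ hz' i)) ?_
    exact ⟨0, Finset.mem_range.2 hp0⟩
  -- By continuity it suffices to treat a point of the dense forward orbit of `z` close enough to
  -- `x`.
  · have hnhds : {y | Agree (m + 1) y x ∧ Agree (m + 1) ((φ ^ t p) y) ((φ ^ t p) x)} ∈ 𝓝 x :=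
      ((isOpen_agree (m + 1) x).inter
        ((isOpen_agree (m + 1) ((φ ^ t p) x)).preimage (φ ^ t p).continuous)).mem_nhds
          ⟨fun _ _ => rfl, fun _ _ => rfl⟩
    obtain ⟨U, hU, hUo, hxU⟩ := mem_nhds_iff.1 hnhds
    obtain ⟨M, hM⟩ := exists_agree_subset hUo hxU
    obtain ⟨s, hs⟩ := exists_pow_agree hsimple hφ hz M x
    obtain ⟨h1, h2⟩ := hU (hM _ hs)
    refine (h2.symm.trans ?_).trans h1
    -- At time `t i + j` the orbit is on floor `j` of the `i`-th tower visited; `t p` steps later it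
    -- is on floor `j` of the `(i + p)`-th, which is the same tower.
    obtain ⟨i, j, hj, rfl⟩ := exists_returnTime_add hφ hz' s
    have h3 : (φ ^ t p) ((φ ^ (t i + j)) z) = (φ ^ j) ((ω.returnMap φ (m + 1))^[i + p] z) := by
      rw [← pow_returnTime, ← Homeomorph.mul_apply, ← Homeomorph.mul_apply, ← pow_add, ← pow_add,
        ← ht, htime]
      congr 2
      omega
    have h4 : (φ ^ (t i + j)) z = (φ ^ j) ((ω.returnMap φ (m + 1))^[i] z) := by
      rw [← pow_returnTime, ← Homeomorph.mul_apply, ← pow_add, ← ht, add_comm]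
    rw [← ht, h3, h4]
    refine tower_agree hφ (iterate_returnMap_mem hφ hz' _) (iterate_returnMap_mem hφ hz' _)
      (hper i) (by rwa [hper i])

theorem exists_pow_agree_self_of_isPeriodicLanguage (hsimple : B.IsSimple)
    {lab : ∀ n, B.V (n + 1) ≃ A} {d : ℕ} (hrank : B.IsStrictRank lab d)
    (hφ : ω.IsVershikMap φ) (hper : IsPeriodicLanguage (ω.language lab)) (m : ℕ) :
    ∃ H : ℕ, 0 < H ∧ ∀ x, Agree m ((φ ^ H) x) x := by
  obtain ⟨p, hp0, hp⟩ := hper.exists_hasPeriod (by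
    obtain ⟨a⟩ := B.nonempty_V (0 + 1 + 0)
    exact ⟨_, word_mem_language hsimple lab 0 0 a, by simp [word, sources]⟩)
  obtain ⟨H, hH, h⟩ := exists_pow_agree_self (m := m) hsimple hrank hφ hp0
    fun k a => hp _ (word_mem_language hsimple lab m k a)
  exact ⟨H, hH, fun x i hi => h x i (by omega)⟩

end Itinerary

end EdgeOrder

/-- If every vertex has at least two incoming edges, then there are infinitely many paths. -/
theorem infinite_pathSpace (ω : B.EdgeOrder)
    (h2 : ∀ (n : ℕ) (a : B.V (n + 1)), 2 ≤ Nat.card {e : B.E n // B.r e = a}) :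
    Infinite B.PathSpace := by
  obtain ⟨x⟩ := (inferInstance : Nonempty B.PathSpace)
  have h : ∀ n, ∃ y : B.PathSpace, y.1 n ≠ x.1 n ∧ ∀ i, n < i → y.1 i = x.1 i := by
    intro n
    have := B.finite_E n
    have hnt : Nontrivial {e : B.E n // B.r e = B.r (x.1 n)} :=
      Finite.one_lt_card_iff_nontrivial.1 (h2 n (B.r (x.1 n)))
    obtain ⟨e, he⟩ := exists_ne (⟨x.1 n, rfl⟩ : {e : B.E n // B.r e = B.r (x.1 n)})
    obtain ⟨y, -, h1, h3⟩ := EdgeOrder.exists_path_through (ω := ω) n x e.1 e.2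
    exact ⟨y, fun h => he (Subtype.ext (h1.symm.trans h)), h3⟩
  choose y hy hy' using h
  -- `n` is the last position at which `y n` differs from `x`, so it can be recovered from `y n`.
  refine Infinite.of_injective y fun i j hij => ?_
  rcases lt_trichotomy i j with h | h | h
  · exact absurd (by rw [← hij]; exact hy' i j h) (hy j)
  · exact h
  · exact absurd (by rw [hij]; exact hy' j i h) (hy i)

end BratteliDiagram

/-! ### Minimal systems: isolated points and conjugation. -/

section Topology

/-- Every orbit would meet an isolated point, making all points isolated; a compact discrete space
is finite. -/
theorem IsMinimalSystem.perfectSpace {Y : Type u} [TopologicalSpace Y] [CompactSpace Y]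
    [Infinite Y] {T : Y ≃ₜ Y} (hT : IsMinimalSystem T) : PerfectSpace Y := by
  rw [perfectSpace_iff_forall_not_isolated]
  intro x
  by_contra hx
  have hopen : IsOpen ({x} : Set Y) :=
    (isOpen_singleton_iff_punctured_nhds x).2 (not_neBot.1 hx)
  have : DiscreteTopology Y := discreteTopology_iff_isOpen_singleton.2 fun y => by
    obtain ⟨_, hk, k, rfl⟩ := (hT y).inter_open_nonempty _ hopen ⟨x, rfl⟩
    have : ({y} : Set Y) = (T ^ k) ⁻¹' {x} := by
      ext z
      rw [Set.mem_preimage, Set.mem_singleton_iff, Set.mem_singleton_iff,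
        ← Set.mem_singleton_iff.1 hk, (T ^ k).injective.eq_iff]
    rw [this]
    exact hopen.preimage (T ^ k).continuous
  have : Finite Y := finite_of_compact_of_discrete
  exact not_finite Y

theorem Homeomorph.conj_zpow {X : Type u} {Y : Type v} [TopologicalSpace X] [TopologicalSpace Y]
    (h : X ≃ₜ Y) (T : X ≃ₜ X) (k : ℤ) :
    ((h.symm.trans T).trans h) ^ k = (h.symm.trans (T ^ k)).trans h :=
  (map_zpow (MonoidHom.mk' (fun T : X ≃ₜ X => (h.symm.trans T).trans h)
    fun a b => Homeomorph.ext fun x => by simp [Homeomorph.mul_apply]) T k).symm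

theorem IsMinimalSystem.conj {X : Type u} {Y : Type v} [TopologicalSpace X] [TopologicalSpace Y]
    {T : X ≃ₜ X} (hT : IsMinimalSystem T) (h : X ≃ₜ Y) :
    IsMinimalSystem ((h.symm.trans T).trans h) := by
  intro y
  have := h.surjective.denseRange.dense_image h.continuous (hT (h.symm y))
  rw [← Set.range_comp] at this
  convert this using 2
  funext k
  rw [h.conj_zpow]
  rfl

end Topology

namespace BratteliDiagram

/-! ### Adic representation of an inverse limit of finite rotations. -/

section Odometer

/-- The Bratteli diagram with one vertex at each level and `d n` edges from level `n` to level
`n + 1`. -/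
def odometer (d : ℕ → ℕ) (hd : ∀ n, 0 < d n) : BratteliDiagram.{0, 0} where
  V _ := Unit
  E n := Fin (d n)
  finite_V _ := inferInstance
  finite_E _ := inferInstance
  s _ := ()
  r _ := ()
  card_V_zero := Nat.card_unique
  s_surjective n _ := ⟨⟨0, hd n⟩, rfl⟩
  r_surjective n _ := ⟨⟨0, hd n⟩, rfl⟩

variable {d : ℕ → ℕ} {hd : ∀ n, 0 < d n}

/-- The natural ordering on the diagram with one vertex at each level. -/
def odometerOrder (d : ℕ → ℕ) (hd : ∀ n, 0 < d n) : (odometer d hd).EdgeOrder where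
  order n a := inferInstanceAs (LinearOrder {_e : Fin (d n) // () = a})

/-- The `n`-th digit of a point of the odometer. -/
def digit (y : (odometer d hd).PathSpace) (n : ℕ) : ℕ := Fin.val (n := d n) (y.1 n)

theorem digit_lt (y : (odometer d hd).PathSpace) (n : ℕ) : digit y n < d n :=
  Fin.isLt (n := d n) (y.1 n)

theorem edge_eq_of_digit_eq {y y' : (odometer d hd).PathSpace} {n : ℕ}
    (h : digit y n = digit y' n) : y.1 n = y'.1 n := Fin.ext (n := d n) h

theorem odometerOrder_lt {n : ℕ} {e f : (odometer d hd).E n} :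
    (odometerOrder d hd).Lt e f ↔ Fin.val (n := d n) e < Fin.val (n := d n) f :=
  ⟨fun ⟨_, h⟩ => h, fun h => ⟨rfl, h⟩⟩

theorem odometerOrder_isMinEdge {y : (odometer d hd).PathSpace} {n : ℕ} :
    (odometerOrder d hd).IsMinEdge (y.1 n) ↔ digit y n = 0 := by
  constructor
  · intro h
    by_contra h0
    exact h (⟨0, hd n⟩ : Fin (d n)) (odometerOrder_lt.2 (Nat.pos_of_ne_zero h0))
  · intro h f hf
    have : _ < digit y n := odometerOrder_lt.1 hf
    omega

theorem odometerOrder_isMaxEdge {y : (odometer d hd).PathSpace} {n : ℕ} :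
    (odometerOrder d hd).IsMaxEdge (y.1 n) ↔ digit y n + 1 = d n := by
  have hlt := digit_lt y n
  constructor
  · intro h
    by_contra h0
    exact h (⟨digit y n + 1, by omega⟩ : Fin (d n)) (odometerOrder_lt.2 (Nat.lt_succ_self _))
  · intro h f hf
    have h1 : digit y n < _ := odometerOrder_lt.1 hf
    have h2 := Fin.isLt (n := d n) f
    omega

theorem odometerOrder_isSucc {y y' : (odometer d hd).PathSpace} {n : ℕ}
    (h : digit y' n = digit y n + 1) : (odometerOrder d hd).IsSucc (y.1 n) (y'.1 n) := by
  refine ⟨odometerOrder_lt.2 (show digit y n < digit y' n by omega), fun g hg => ?_⟩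
  have h1 : digit y n < _ := odometerOrder_lt.1 hg.1
  have h2 : _ < digit y' n := odometerOrder_lt.1 hg.2
  omega

/-- A homeomorphism `T` which is encoded by a compatible family of clopen maps `f n` onto
`ℤ / q n`, turning `T` into the addition of `1`, is an adic transformation on a diagram with one
vertex at each level. -/
theorem exists_odometer_conj {X : Type v} [TopologicalSpace X] [CompactSpace X] [Nonempty X]
    (T : X ≃ₜ X) (q : ℕ → ℕ) (hq0 : q 0 = 1) (hqpos : ∀ n, 0 < q n) (hdvd : ∀ n, q n ∣ q (n + 1))
    (f : ℕ → X → ℕ) (hf : ∀ n, IsLocallyConstant (f n)) (hlt : ∀ n x, f n x < q n)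
    (hT : ∀ n x, f n (T x) = (f n x + 1) % q n) (hmod : ∀ n x, f (n + 1) x % q n = f n x)
    (hinj : ∀ x y, (∀ n, f n x = f n y) → x = y) :
    ∃ (B : BratteliDiagram.{0, 0}) (ω : B.EdgeOrder) (h : X ≃ₜ B.PathSpace),
      (∀ n, Nat.card (B.V n) = 1) ∧ ω.IsVershikMap ((h.symm.trans T).trans h) := by
  choose d hd using hdvd
  have hdpos : ∀ n, 0 < d n := fun n =>
    Nat.pos_of_mul_pos_left (a := q n) (by rw [← hd]; exact hqpos _)
  have hdig : ∀ n x, f (n + 1) x / q n < d n := fun n x =>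
    Nat.div_lt_of_lt_mul (by rw [← hd]; exact hlt _ _)
  have hf0 : ∀ x, f 0 x = 0 := fun x => by have := hlt 0 x; omega
  -- Mixed-radix digits of the compatible residues `f n x`, with bases `d n = q (n + 1) / q n`.
  let g : X → (odometer d hdpos).PathSpace := fun x =>
    ⟨fun n => (⟨f (n + 1) x / q n, hdig n x⟩ : Fin (d n)), fun _ => rfl⟩
  have hrec : ∀ n x, f (n + 1) x = f n x + q n * digit (g x) n := fun n x => by
    rw [← hmod n x]
    exact (Nat.mod_add_div _ _).symm
  have hginj : Function.Injective g := by
    intro x y hxy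
    refine hinj x y fun n => ?_
    induction n with
    | zero => rw [hf0, hf0]
    | succ n ih => rw [hrec, hrec, ih, hxy]
  have hgcont : Continuous g := by
    let _ : ∀ n, TopologicalSpace ((odometer d hdpos).E n) := fun _ => ⊥
    refine continuous_induced_rng.2 (continuous_pi fun n => IsLocallyConstant.continuous ?_)
    rw [IsLocallyConstant.iff_eventually_eq]
    intro x
    filter_upwards [(IsLocallyConstant.iff_eventually_eq _).1 (hf (n + 1)) x] with y hy
    exact Fin.ext (n := d n) (by change f (n + 1) y / q n = f (n + 1) x / q n; rw [hy])
  have hpow : ∀ n k x, f n ((T ^ k) x) = (f n x + k) % q n := by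
    intro n k x
    induction k with
    | zero => exact (Nat.mod_eq_of_lt (hlt n x)).symm
    | succ k ih => rw [pow_succ', Homeomorph.mul_apply, hT, ih, Nat.mod_add_mod, add_assoc]
  have hgsurj : Function.Surjective g := by
    intro y
    by_contra hy
    obtain ⟨m, hm⟩ := exists_agree_subset (isCompact_range hgcont).isClosed.isOpen_compl hy
    -- The residue modulo `q n` that the first `n` digits of `y` encode. A power of `T` carries any
    -- point to residue `N m`, and so into the cylinder of `y` that was supposed to miss the range.
    let N : ℕ → ℕ := fun n => ∑ i ∈ Finset.range n, q i * digit y i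
    have hN : ∀ n, N (n + 1) = N n + q n * digit y n := fun n => Finset.sum_range_succ _ _
    have hNlt : ∀ n, N n < q n := by
      intro n
      induction n with
      | zero => simpa [N] using hqpos 0
      | succ n ih =>
        have : q n * (digit y n + 1) ≤ q n * d n := Nat.mul_le_mul_left _ (digit_lt y n)
        rw [hN, hd]
        rw [mul_add, mul_one] at this
        omega
    obtain ⟨x⟩ := (inferInstance : Nonempty X)
    let x' := (T ^ (N m + q m - f m x)) x
    have hx' : f m x' = N m := by
      have := hlt m x
      rw [hpow, show f m x + (N m + q m - f m x) = N m + q m by omega, Nat.add_mod_right,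
        Nat.mod_eq_of_lt (hNlt m)]
    have hall : ∀ j ≤ m, f j x' = N j := by
      intro j hj
      induction hj using Nat.decreasingInduction with
      | self => exact hx'
      | of_succ j _ ih =>
        rw [← hmod, ih, hN, Nat.add_mul_mod_self_left, Nat.mod_eq_of_lt (hNlt j)]
    refine hm (g x') (fun j hj => edge_eq_of_digit_eq ?_) ⟨x', rfl⟩
    have := hrec j x'
    rw [hall j (by omega), hall (j + 1) hj, hN] at this
    exact (Nat.eq_of_mul_eq_mul_left (hqpos j) (Nat.add_left_cancel this)).symm
  let h : X ≃ₜ (odometer d hdpos).PathSpace :=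
    hgcont.homeoOfEquivCompactToT2 (f := Equiv.ofBijective g ⟨hginj, hgsurj⟩)
  have hzero : ∀ n x, (∀ j < n, digit (g x) j = 0) ↔ f n x = 0 := by
    intro n x
    induction n with
    | zero => simp [hf0]
    | succ n ih =>
      rw [Nat.forall_lt_succ_right, ih, hrec]
      simp [(hqpos n).ne']
  have hmax : ∀ n x, (∀ j < n, digit (g x) j + 1 = d j) ↔ f n x + 1 = q n := by
    intro n x
    induction n with
    | zero => simp [hf0, hq0]
    | succ n ih =>
      rw [Nat.forall_lt_succ_right, ih, hrec, hd]
      have h1 := digit_lt (g x) n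
      have h2 := hlt n x
      constructor
      · rintro ⟨h3, h4⟩
        rw [← h4, mul_add, mul_one]
        omega
      · intro h3
        have h4 : digit (g x) n + 1 = d n := by
          by_contra h5
          have h6 : q n * (digit (g x) n + 1 + 1) ≤ q n * d n := Nat.mul_le_mul_left _ (by omega)
          simp only [mul_add, mul_one] at h6
          omega
        rw [← h4, mul_add, mul_one] at h3
        exact ⟨by omega, h4⟩
  refine ⟨odometer d hdpos, odometerOrder d hdpos, h,
    fun n => (Nat.card_unique : Nat.card Unit = 1), ?_, ?_⟩
  · ext y
    obtain ⟨x, rfl⟩ := h.surjective y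
    obtain ⟨x, rfl⟩ := T.surjective x
    have h1 : h (T x) ∈ ((h.symm.trans T).trans h) '' (odometerOrder d hdpos).maxPaths ↔
        h x ∈ (odometerOrder d hdpos).maxPaths := by
      constructor
      · rintro ⟨y, hy, hy'⟩
        have : y = h x := by
          rw [← h.symm_apply_eq]
          exact T.injective (h.injective hy')
        rwa [← this]
      · exact fun hx => ⟨h x, hx, by simp⟩
    have h2 : h x ∈ (odometerOrder d hdpos).maxPaths ↔ ∀ n, f n x + 1 = q n := by
      constructor
      · exact fun hx n => (hmax n x).1 fun j _ => odometerOrder_isMaxEdge.1 (hx j)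
      · exact fun hx n => odometerOrder_isMaxEdge.2
          ((hmax (n + 1) x).2 (hx (n + 1)) n (Nat.lt_succ_self n))
    have h3 : h (T x) ∈ (odometerOrder d hdpos).minPaths ↔ ∀ n, f n (T x) = 0 := by
      constructor
      · exact fun hx n => (hzero n _).1 fun j _ => odometerOrder_isMinEdge.1 (hx j)
      · exact fun hx n => odometerOrder_isMinEdge.2
          ((hzero (n + 1) _).2 (hx (n + 1)) n (Nat.lt_succ_self n))
    rw [h1, h2, h3]
    refine forall_congr' fun n => ?_
    rw [hT, ← Nat.dvd_iff_mod_eq_zero]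
    have := hlt n x
    exact ⟨fun h => h ▸ dvd_rfl, fun h => le_antisymm this (Nat.le_of_dvd (Nat.succ_pos _) h)⟩
  · intro y k hy hk
    obtain ⟨x, rfl⟩ := h.surjective y
    have hTx : ((h.symm.trans T).trans h) (h x) = g (T x) := by
      change h (T (h.symm (h x))) = h (T x)
      rw [h.symm_apply_apply]
    rw [hTx]
    change (∀ j < k, (odometerOrder d hdpos).IsMaxEdge ((g x).1 j)) at hy
    change ¬ (odometerOrder d hdpos).IsMaxEdge ((g x).1 k) at hk
    simp only [odometerOrder_isMaxEdge] at hy hk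
    have hk' : f k x + 1 = q k := (hmax k x).1 hy
    -- Digit `k` is not maximal, so adding `1` does not overflow modulo `q j` for `j > k`: the carry
    -- stops at `k`.
    have hlate : ∀ j, k < j → f j (T x) = f j x + 1 := fun j hj => by
      rw [hT]
      refine Nat.mod_eq_of_lt (lt_of_le_of_ne (hlt j x) fun h => hk ?_)
      exact (hmax j x).2 h k hj
    have hkT : f k (T x) = 0 := by rw [hT, hk', Nat.mod_self]
    refine ⟨fun j hj => odometerOrder_isMinEdge.2 ((hzero k _).2 hkT j hj),
      odometerOrder_isSucc (y := g x) ?_, fun j hj => edge_eq_of_digit_eq (y' := g x) ?_⟩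
    · have h1 := hlate (k + 1) (Nat.lt_succ_self k)
      rw [hrec, hrec, hkT, zero_add] at h1
      refine Nat.eq_of_mul_eq_mul_left (hqpos k) ?_
      rw [h1, mul_add, mul_one]
      omega
    · have h1 := hlate (j + 1) (by omega)
      rw [hrec, hrec, hlate j hj] at h1
      exact Nat.eq_of_mul_eq_mul_left (hqpos j) (by omega)

end Odometer

/-! ### From periodic cylinders to an odometer. -/

section Equicontinuous

variable {B : BratteliDiagram.{u, v}} {φ : B.PathSpace ≃ₜ B.PathSpace}

/-- The integers `k` such that `φ ^ k` preserves all cylinder sets of length `m` are the multiples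
of a positive integer, as soon as one of them is positive. -/
theorem exists_period {m : ℕ} (h : ∃ H : ℕ, 0 < H ∧ ∀ x, Agree m ((φ ^ H) x) x) :
    ∃ q : ℕ, 0 < q ∧ ∀ k : ℤ, (∀ x, Agree m ((φ ^ k) x) x) ↔ (q : ℤ) ∣ k := by
  let S : AddSubgroup ℤ :=
    { carrier := {k | ∀ x, Agree m ((φ ^ k) x) x}
      zero_mem' := fun x i _ => by rw [zpow_zero]; rfl
      add_mem' := fun {a b} ha hb x => by
        rw [zpow_add, Homeomorph.mul_apply]
        exact (ha _).trans (hb x)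
      neg_mem' := fun {a} ha x => by
        have := ha ((φ ^ (-a)) x)
        rw [← Homeomorph.mul_apply, ← zpow_add, add_neg_cancel, zpow_zero] at this
        exact this.symm }
  obtain ⟨a, ha⟩ := Int.subgroup_cyclic S
  have hS : ∀ k : ℤ, (∀ x, Agree m ((φ ^ k) x) x) ↔ (a.natAbs : ℤ) ∣ k := fun k => by
    change k ∈ S ↔ _
    rw [ha, AddSubgroup.mem_closure_singleton, Int.natAbs_dvd]
    simp only [dvd_def, smul_eq_mul, mul_comm a, eq_comm]
  obtain ⟨H, hH, hH'⟩ := h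
  refine ⟨a.natAbs, Nat.pos_of_ne_zero fun h0 => ?_, hS⟩
  have := (hS H).1 (by simpa only [zpow_natCast] using hH')
  rw [h0, Nat.cast_zero, zero_dvd_iff] at this
  omega

theorem agree_self_of_dense {m : ℕ} {g : B.PathSpace ≃ₜ B.PathSpace} {D : Set B.PathSpace}
    (hD : Dense D) (h : ∀ y ∈ D, Agree m (g y) y) (x : B.PathSpace) : Agree m (g x) x := by
  obtain ⟨y, ⟨h1, h2⟩, hy⟩ := hD.inter_open_nonempty
    ({y | Agree m y x} ∩ g ⁻¹' {y | Agree m y (g x)})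
    ((isOpen_agree m x).inter ((isOpen_agree m (g x)).preimage g.continuous))
    ⟨x, fun _ _ => rfl, fun _ _ => rfl⟩
  exact (Agree.symm h2).trans ((h y hy).trans h1)

variable (φ) in
/-- The orbits of `x` and `y` pass through the same cylinder sets of length `m` at all times. -/
def OrbitAgree (m : ℕ) (x y : B.PathSpace) : Prop := ∀ i : ℤ, Agree m ((φ ^ i) x) ((φ ^ i) y)

theorem OrbitAgree.symm {m : ℕ} {x y : B.PathSpace} (h : OrbitAgree φ m x y) :
    OrbitAgree φ m y x := fun i => (h i).symm

theorem OrbitAgree.trans {m : ℕ} {x y z : B.PathSpace} (h : OrbitAgree φ m x y)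
    (h' : OrbitAgree φ m y z) : OrbitAgree φ m x z := fun i => (h i).trans (h' i)

theorem OrbitAgree.zpow {m : ℕ} {x y : B.PathSpace} (h : OrbitAgree φ m x y) (k : ℤ) :
    OrbitAgree φ m ((φ ^ k) x) ((φ ^ k) y) := fun i => by
  simpa only [← Homeomorph.mul_apply, ← zpow_add] using h (i + k)

theorem OrbitAgree.mono {m n : ℕ} {x y : B.PathSpace} (h : OrbitAgree φ n x y) (hmn : m ≤ n) :
    OrbitAgree φ m x y := fun i j hj => h i j (hj.trans_le hmn)

theorem agree_zpow_emod {m q : ℕ}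
    (hq : ∀ k : ℤ, (∀ x, Agree m ((φ ^ k) x) x) ↔ (q : ℤ) ∣ k) (k : ℤ) (x : B.PathSpace) :
    Agree m ((φ ^ k) x) ((φ ^ (k % q)) x) := by
  have := (hq (q * (k / q))).2 (dvd_mul_right _ _) ((φ ^ (k % q)) x)
  rwa [← Homeomorph.mul_apply, ← zpow_add, Int.mul_ediv_add_emod] at this

theorem orbitAgree_zpow_emod {m q : ℕ}
    (hq : ∀ k : ℤ, (∀ x, Agree m ((φ ^ k) x) x) ↔ (q : ℤ) ∣ k) (k : ℤ) (x : B.PathSpace) :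
    OrbitAgree φ m ((φ ^ k) x) ((φ ^ (k % q)) x) := fun i => by
  simp only [← Homeomorph.mul_apply, ← zpow_add]
  have h := agree_zpow_emod hq (i + k % q) x
  rw [Int.add_emod_emod] at h
  exact (agree_zpow_emod hq (i + k) x).trans h.symm

/-- By periodicity, agreement at the `q` times `0, …, q - 1` implies agreement at all times. -/
theorem isOpen_orbitAgree {m q : ℕ} (hq0 : 0 < q)
    (hq : ∀ k : ℤ, (∀ x, Agree m ((φ ^ k) x) x) ↔ (q : ℤ) ∣ k) (x : B.PathSpace) :
    IsOpen {y | OrbitAgree φ m y x} := by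
  have : {y | OrbitAgree φ m y x} =
      ⋂ i ∈ Set.Ico (0 : ℤ) q, (φ ^ i) ⁻¹' {y | Agree m y ((φ ^ i) x)} := by
    ext y
    simp only [Set.mem_iInter, Set.mem_preimage]
    refine ⟨fun h i _ => h i, fun h i => ?_⟩
    exact ((agree_zpow_emod hq i y).trans
      (h (i % q) ⟨Int.emod_nonneg _ (by omega), Int.emod_lt_of_pos _ (by omega)⟩)).trans
        (Agree.symm (agree_zpow_emod hq i x))
  rw [this]
  exact (Set.finite_Ico (0 : ℤ) q).isOpen_biInter fun i _ =>
    (isOpen_agree m _).preimage (φ ^ i).continuous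

/-- Agreement at one time would not suffice, as a cylinder may be visited at several residues.
Agreement of whole orbits makes `φ ^ (k - l)` preserve cylinders along a dense orbit, hence
everywhere. -/
theorem dvd_sub_of_orbitAgree {m q : ℕ}
    (hq : ∀ k : ℤ, (∀ x, Agree m ((φ ^ k) x) x) ↔ (q : ℤ) ∣ k) (hmin : IsMinimalSystem φ)
    {x : B.PathSpace} {k l : ℤ} (h : OrbitAgree φ m ((φ ^ k) x) ((φ ^ l) x)) :
    (q : ℤ) ∣ k - l := by
  refine (hq _).1 (agree_self_of_dense (hmin x) ?_)
  rintro _ ⟨j, rfl⟩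
  have := h (j - l)
  simp only [← Homeomorph.mul_apply, ← zpow_add] at this ⊢
  rwa [sub_add_cancel, show j - l + k = k - l + j by ring] at this

/-- A minimal homeomorphism of a path space such that, for each `m`, a positive power of it
preserves all cylinder sets of length `m`, is conjugate to an odometer. -/
theorem exists_isOdometer_conj [Infinite B.PathSpace] (hmin : IsMinimalSystem φ)
    (hper : ∀ m, ∃ H : ℕ, 0 < H ∧ ∀ x, Agree m ((φ ^ H) x) x) :
    ∃ (Y : Type) (_ : TopologicalSpace Y) (T : Y ≃ₜ Y),
      IsOdometer T ∧ TopologicallyConjugate φ T := by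
  obtain ⟨x₀⟩ := (inferInstance : Nonempty B.PathSpace)
  choose q hq0 hq using fun m => exists_period (hper m)
  -- The residue `k` is the time at which the orbit of `x₀` runs in step with that of `x`.
  have hex : ∀ m x, ∃ k : ℕ, k < q m ∧ OrbitAgree φ m x ((φ ^ (k : ℤ)) x₀) := by
    intro m x
    obtain ⟨_, hk, k, rfl⟩ := (hmin x₀).inter_open_nonempty _
      (isOpen_orbitAgree (hq0 m) (hq m) x) ⟨x, fun _ _ _ => rfl⟩
    have h0 : 0 ≤ k % q m := Int.emod_nonneg _ (by have := hq0 m; omega)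
    have h1 : k % q m < q m := Int.emod_lt_of_pos _ (by have := hq0 m; omega)
    refine ⟨(k % q m).toNat, by omega, ?_⟩
    rw [Int.toNat_of_nonneg h0]
    exact (OrbitAgree.symm hk).trans (orbitAgree_zpow_emod (hq m) k x₀)
  choose f hlt hf using hex
  have huniq : ∀ m x (k : ℤ), OrbitAgree φ m x ((φ ^ k) x₀) → (f m x : ℤ) = k % q m := by
    intro m x k hk
    have h1 := dvd_sub_of_orbitAgree (hq m) hmin ((hf m x).symm.trans hk)
    rw [← Int.emod_eq_emod_iff_emod_sub_eq_zero.2 (Int.emod_eq_zero_of_dvd h1)]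
    exact (Int.emod_eq_of_lt (Int.natCast_nonneg _) (by exact_mod_cast hlt m x)).symm
  have hdvd : ∀ m, q m ∣ q (m + 1) := fun m => by
    have := (hq m (q (m + 1))).1 fun x i hi => (hq (m + 1) (q (m + 1))).2 dvd_rfl x i (by omega)
    exact_mod_cast this
  obtain ⟨B', ω', h, hcard, hV⟩ := exists_odometer_conj φ q
    -- Cylinders of length `0` impose no condition, so `q 0 = 1`.
    (by have := (hq 0 1).1 fun x i hi => absurd hi (Nat.not_lt_zero i)
        exact Nat.dvd_one.1 (by exact_mod_cast this))
    hq0 hdvd f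
    (fun m => (IsLocallyConstant.iff_eventually_eq _).2 fun x => by
      filter_upwards [(isOpen_orbitAgree (hq0 m) (hq m) x).mem_nhds
        (show OrbitAgree φ m x x from fun _ _ _ => rfl)] with y hy
      have h1 := huniq m y _ (OrbitAgree.trans hy (hf m x))
      have h2 := huniq m x _ (hf m x)
      omega)
    hlt
    (fun m x => by
      have h1 := (hf m x).zpow 1
      rw [← Homeomorph.mul_apply, ← zpow_add, zpow_one] at h1
      have h2 := huniq m (φ x) _ h1
      rw [add_comm] at h2
      exact_mod_cast h2)
    (fun m x => by
      have h1 := huniq m x _ ((hf (m + 1) x).mono (Nat.le_succ m))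
      exact_mod_cast h1.symm)
    (fun x y hxy => Subtype.ext (funext fun n => by
      have h1 := hf (n + 1) x
      rw [hxy (n + 1)] at h1
      exact h1.trans (hf (n + 1) y).symm 0 n (Nat.lt_succ_self n)))
  have hmin' := hmin.conj h
  have : Infinite B'.PathSpace := Infinite.of_injective h h.injective
  exact ⟨B'.PathSpace, inferInstance, (h.symm.trans φ).trans h,
    ⟨⟨inferInstance, inferInstance, inferInstance, inferInstance, hmin'.perfectSpace⟩, hmin',
      B', ω', _, hcard, hV, Homeomorph.refl _, fun _ => rfl⟩,
    h, fun x => by simp⟩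

end Equicontinuous

end BratteliDiagram

theorem mainTheorem12 {B : BratteliDiagram.{u, v}} {A : Type w} (lab : ∀ n, B.V (n + 1) ≃ A)
    (d : ℕ) (hsimple : B.IsSimple) (hrank : B.IsStrictRank lab d)
    (ω : B.EdgeOrder) (hperfect : ω.IsPerfect)
    (hperiodic : IsPeriodicLanguage (ω.language lab)) :
    ∀ φ : B.PathSpace ≃ₜ B.PathSpace, ω.IsVershikMap φ →
      ∃ (Y : Type) (_ : TopologicalSpace Y) (T : Y ≃ₜ Y),
        IsOdometer T ∧ TopologicallyConjugate φ T := by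
  intro φ hφ
  have := BratteliDiagram.infinite_pathSpace ω hrank.two_le
  exact BratteliDiagram.exists_isOdometer_conj
    (BratteliDiagram.EdgeOrder.isMinimalSystem hsimple hφ)
    (BratteliDiagram.EdgeOrder.exists_pow_agree_self_of_isPeriodicLanguage hsimple hrank hφ
      hperiodic)
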